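/- Let $X$ be a topological space, $\mathbb F$ a field, $k\in\mathbb N$, and let $f,g\colon X\to\mathbb N$ be functions that are bounded on every compact subset of $X$ (for instance continuous functions, or functions on a simplicial complex that are constant on open simplices). Let $M_f$, $M_g$ and $M_{(f,g)}$ be the persistence modules obtained by applying $H_k(\,\cdot\,;\mathbb F)$ (singular homology) to the sublevel filtrations $\{f\le i\}_{i\in\mathbb N}$, $\{g\le j\}_{j\in\mathbb N}$ and $\{f\le i,\ g\le j\}_{(i,j)\in\mathbb N^2}$. Assume that all three are of finite type, i.e. finitely generated as $\mathbb N$-graded modules over $\mathbb F[x]$ and $\mathbb F[y]$, and as an $\mathbb N^2$-graded module over $\mathbb F[x,y]$, respectively. Let $PD_k(f)$ be the persistence diagram of $M_f$: the multiset of points $(b,d)$ with $b\in\mathbb N$, $d\in\mathbb N\cup\{\infty\}$, $b<d$, with their usual multiplicities, together with countably infinitely many copies of every diagonal point $(b,b)$, $b\in\mathbb N$; similarly $PD_k(g)$. For a bijection $\gamma\colon PD_k(f)\to PD_k(g)$, let the $\gamma$-product $M_f\circledast_\gamma M_g$ be the $\mathbb N^2$-graded $\mathbb F[x,y]$-module with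 one generator $e_s$ of bidegree $(b,b')$ for every point $s=(b,d)$ of $PD_k(f)$, where $(b',d')=\gamma(s)$, except for those diagonal points $s$ for which $\gamma(s)$ is also on the diagonal, and with the relations $e_s\,x^{d-b}y^{d'-b'}=0$ (no relation for $e_s$ if $d=\infty$ or $d'=\infty$). Two $\mathbb N^2$-graded modules $M,N$ are $\delta$-interleaved, $\delta\in\mathbb N$, if there are morphisms $M_r\to N_{r+(\delta,\delta)}$ and $N_r\to M_{r+(\delta,\delta)}$, $r\in\mathbb N^2$, of graded modules whose two composites are the multiplications by $(xy)^{2\delta}$; the interleaving distance $d_I(M,N)\in\mathbb N\cup\{\infty\}$ is the infimum of such $\delta$. Denote by $\bar\gamma$ any bijection with $$d_I\big(M_{(f,g)},\,M_f\circledast_{\bar\gamma}M_g\big)=\inf_\gamma d_I\big(M_{(f,g)},\,M_f\circledast_{\gamma}M_g\big).$$ Suppose that $M_{(f,g)}$ is hook-decomposable, i.e. isomorphic to a direct sum of interval modules whose supports are of the form $\{r\in\mathbb N^2\mid r\ge p,\ r\not\ge q\}$ with $p,q\in\mathbb N^2\cup\{\infty\}$, $p\le q$ (product order, with $\infty$ above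 every element of $\mathbb N^2$). Then a minimizing bijection $\bar\gamma$ exists, and for every minimizing bijection $\bar\gamma$ there is an isomorphism of $\mathbb N^2$-graded $\mathbb F[x,y]$-modules $$M_{(f,g)}\;\cong\;M_f\circledast_{\bar\gamma}M_g.$$ -/

import Mathlib

open CategoryTheory

universe u

noncomputable section

namespace PersistenceProduct

/-! ### Persistence modules over a poset

A persistence module indexed by a poset `P` is a functor from `P` to `F`-vector spaces. For `P = ℕ`
and `P = ℕ × ℕ` these are the same as `ℕ`-graded `F[x]`-modules and `ℕ²`-graded `F[x,y]`-modules: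
the degree `r` part is the value at `r`, and the monomials act by the structure maps. Morphisms of
functors are the degree-preserving linear maps commuting with the action. -/

/-- On `ℕ × ℕ` the category structure is that of the product poset. -/
instance bidegreeCategory : SmallCategory (ℕ × ℕ) := Preorder.smallCategory (ℕ × ℕ)

/-- Persistence modules over the poset `P`, as functors from the category of the poset `P`. -/
abbrev PersistenceModule (F : Type u) [Field F] (P : Type) [Preorder P] :=
  P ⥤ ModuleCat.{u} F

/-- The sublevel filtration of a map `φ : X → P`, with `X` a topological space:
`r ↦ {x | φ x ≤ r}` (with the subspace topology) and the inclusions. -/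
def sublevelFiltration {P : Type} [Preorder P] {X : Type u} [TopologicalSpace X] (φ : X → P) :
    P ⥤ TopCat.{u} where
  obj r := TopCat.of {x : X // φ x ≤ r}
  map {_ _} h := TopCat.ofHom
    ⟨fun x => ⟨x.1, x.2.trans h.le⟩, continuous_subtype_val.subtype_mk _⟩

/-- The persistence module of `φ : X → P`: the `k`-th singular homology with coefficients in `F`
of the sublevel filtration of `φ`. -/
def persistenceModule (F : Type u) [Field F] (k : ℕ) {P : Type} [Preorder P] {X : Type u}
    [TopologicalSpace X] (φ : X → P) : PersistenceModule F P :=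
  sublevelFiltration φ ⋙
    (AlgebraicTopology.singularHomologyFunctor (ModuleCat.{u} F) k).obj (ModuleCat.of F F)

/-- A function that is continuous (for the discrete topology on `ℕ`) is bounded on each compact
set. -/
theorem bddAbove_image_of_continuous {X : Type u} [TopologicalSpace X] {f : X → ℕ}
    (hf : Continuous f) (K : Set X) (hK : IsCompact K) : BddAbove (f '' K) :=
  (hK.image hf).bddAbove

variable {F : Type u} [Field F]

/-- A persistence module is of finite type if it is generated by finitely many homogeneous
elements, i.e. if the corresponding graded module is finitely generated. -/
def IsFiniteType {P : Type} [Preorder P] (M : PersistenceModule F P) : Prop :=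
  ∃ (n : ℕ) (deg : Fin n → P) (v : ∀ i, M.obj (deg i)), ∀ r : P,
    Submodule.span F {w : M.obj r | ∃ (i : Fin n) (h : deg i ≤ r),
      w = (M.map (homOfLE h)).hom (v i)} = ⊤

/-! ### Persistence diagrams of monoparameter modules -/

/-- The rank of the structure map from degree `a` to degree `c` (it is used for `a ≤ c` only). -/
def structureRank (M : PersistenceModule F ℕ) (a c : ℕ) : ℕ :=
  if h : a ≤ c then Module.finrank F (LinearMap.range (M.map (homOfLE h)).hom) else 0

/-- The number of classes born exactly at `b` that are still alive at `c ≥ b`: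
`rank (M b → M c) - rank (M (b - 1) → M c)`, where `M (-1) = 0`. -/
def bornAt (M : PersistenceModule F ℕ) (b c : ℕ) : ℕ :=
  structureRank M b c - (if 0 < b then structureRank M (b - 1) c else 0)

/-- The multiplicity of the off-diagonal point `(b, d)`, `b < d ≤ ∞`, of the persistence diagram:
the number of classes born exactly at `b` that are alive at `d - 1` and not at `d`, or, for `d = ∞`,
that are alive at all later times. -/
def pointMultiplicity (M : PersistenceModule F ℕ) (b : ℕ) : ℕ∞ → ℕ
  | (d : ℕ) => bornAt M b (d - 1) - bornAt M b d
  | ⊤ => ⨅ n : ℕ, bornAt M b (b + n)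

/-- The persistence diagram, as the type of its points: `⟨⟨(b, d), n⟩, _⟩` is the `n`-th copy of the
point `(b, d)`. An off-diagonal point has as many copies as its multiplicity, and every diagonal
point has countably infinitely many. -/
def Diagram (M : PersistenceModule F ℕ) : Type :=
  {t : (ℕ × ℕ∞) × ℕ // (t.1.1 : ℕ∞) ≤ t.1.2 ∧
    ((t.1.1 : ℕ∞) < t.1.2 → t.2 < pointMultiplicity M t.1.1 t.1.2)}

/-- The birth of a point of a persistence diagram. -/
def Diagram.birth {M : PersistenceModule F ℕ} (s : Diagram M) : ℕ := s.1.1.1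

/-- The death of a point of a persistence diagram. -/
def Diagram.death {M : PersistenceModule F ℕ} (s : Diagram M) : ℕ∞ := s.1.1.2

/-- The point lies on the diagonal. -/
def Diagram.OnDiagonal {M : PersistenceModule F ℕ} (s : Diagram M) : Prop :=
  (s.birth : ℕ∞) = s.death

/-! ### The `γ`-product -/

section Presented

variable (F) {S : Type} (birth : S → ℕ × ℕ) (death : S → ℕ∞ × ℕ∞)

/-- In bidegree `r`, the free bigraded module on generators `e s`, `s : S`, of bidegree `birth s`
has the basis `e s * x ^ (r.1 - (birth s).1) * y ^ (r.2 - (birth s).2)`, `birth s ≤ r`. -/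
abbrev FreePart (r : ℕ × ℕ) : Type u := {s : S // birth s ≤ r} →₀ F

/-- The multiples, in bidegree `r`, of the relations `e s * x ^ (d - b) * y ^ (d' - b') = 0`, where
`birth s = (b, b')` and `death s = (d, d')`. There is no relation if `d = ∞` or `d' = ∞`. -/
def relations (r : ℕ × ℕ) : Submodule F (FreePart F birth r) :=
  Submodule.span F {w | ∃ s : {s : S // birth s ≤ r},
    (death s.1).1 ≤ (r.1 : ℕ∞) ∧ (death s.1).2 ≤ (r.2 : ℕ∞) ∧ w = Finsupp.single s 1}

/-- Multiplication by the monomial of bidegree `r' - r` on the free module. -/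
def freeMap {r r' : ℕ × ℕ} (h : r ≤ r') : FreePart F birth r →ₗ[F] FreePart F birth r' :=
  Finsupp.lmapDomain F F fun s => ⟨s.1, s.2.trans h⟩

theorem relations_le_comap {r r' : ℕ × ℕ} (h : r ≤ r') :
    relations F birth death r ≤ (relations F birth death r').comap (freeMap F birth h) := by
  refine Submodule.span_le.2 ?_
  rintro _ ⟨s, h1, h2, rfl⟩
  refine Submodule.subset_span ⟨⟨s.1, s.2.trans h⟩, ?_, ?_, ?_⟩
  · exact h1.trans (by exact_mod_cast h.1)
  · exact h2.trans (by exact_mod_cast h.2)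
  · simp [freeMap, Finsupp.lmapDomain_apply, Finsupp.mapDomain_single]

/-- The `ℕ²`-graded `F[x,y]`-module with generators `e s` of bidegree `birth s = (b, b')` and
relations `e s * x ^ (d - b) * y ^ (d' - b') = 0`, where `(d, d') = death s`. -/
def presentedModule : PersistenceModule F (ℕ × ℕ) where
  obj r := ModuleCat.of F (FreePart F birth r ⧸ relations F birth death r)
  map {_ _} h := ModuleCat.ofHom
    (Submodule.mapQ _ _ (freeMap F birth h.le) (relations_le_comap F birth death h.le))
  map_id r := by
    ext s
    simp [freeMap, Finsupp.lmapDomain_apply, Finsupp.mapDomain_single]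
  map_comp {_ _ _} h h' := by
    ext s
    simp [freeMap, Finsupp.lmapDomain_apply, Finsupp.mapDomain_single]

end Presented

variable {M N : PersistenceModule F ℕ}

/-- The set of those points of the first diagram that index the generators of the `γ`-product: all
points, except for the diagonal points that `γ` sends to a diagonal point. -/
def GeneratorIndex (γ : Diagram M ≃ Diagram N) : Type :=
  {s : Diagram M // ¬ (s.OnDiagonal ∧ (γ s).OnDiagonal)}

/-- The `γ`-product of two monoparameter persistence modules. For each point `(b, d)` of the first
diagram that `γ` sends to `(b', d')`, unless both are on the diagonal, it has one generator, of
bidegree `(b, b')`, with the relation that `x ^ (d - b) * y ^ (d' - b')` annihilates it. -/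
def gammaProduct (γ : Diagram M ≃ Diagram N) : PersistenceModule F (ℕ × ℕ) :=
  presentedModule F (S := GeneratorIndex γ)
    (fun s => (s.1.birth, (γ s.1).birth)) (fun s => (s.1.death, (γ s.1).death))

/-! ### The interleaving distance of biparameter modules -/

/-- The shift of a biparameter module by `(δ, δ)`. -/
def diagonalShift (M : PersistenceModule F (ℕ × ℕ)) (δ : ℕ) : PersistenceModule F (ℕ × ℕ) :=
  (show Monotone fun r : ℕ × ℕ => r + (δ, δ) from fun _ _ h => add_le_add_left h _).functor ⋙ M

/-- `M` and `N` are `δ`-interleaved. -/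
def Interleaved (M N : PersistenceModule F (ℕ × ℕ)) (δ : ℕ) : Prop :=
  ∃ (φ : M ⟶ diagonalShift N δ) (ψ : N ⟶ diagonalShift M δ), ∀ r : ℕ × ℕ,
    φ.app r ≫ ψ.app (r + (δ, δ)) =
        M.map (homOfLE (le_self_add.trans le_self_add : r ≤ r + (δ, δ) + (δ, δ))) ∧
      ψ.app r ≫ φ.app (r + (δ, δ)) =
        N.map (homOfLE (le_self_add.trans le_self_add : r ≤ r + (δ, δ) + (δ, δ)))

/-- The interleaving distance: the infimum of the `δ` such that `M` and `N` are `δ`-interleaved,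
and `∞` if there are none. -/
def interleavingDistance (M N : PersistenceModule F (ℕ × ℕ)) : ℕ∞ :=
  sInf {e : ℕ∞ | ∃ δ : ℕ, e = δ ∧ Interleaved M N δ}

/-- `γ` is a bijection of diagrams that minimizes the interleaving distance between the biparameter
module `B` and the `γ`-product. -/
def IsGammaBar (B : PersistenceModule F (ℕ × ℕ)) (γ : Diagram M ≃ Diagram N) : Prop :=
  interleavingDistance B (gammaProduct γ) =
    ⨅ γ' : Diagram M ≃ Diagram N, interleavingDistance B (gammaProduct γ')

/-! ### Hook-decomposable modules -/

/-- The support of a hook module, `{r | r ≥ p, r ≱ q}`, for `p, q ∈ ℕ² ∪ {∞}`. -/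
def hook (p q : WithTop (ℕ × ℕ)) : Set (ℕ × ℕ) :=
  {r | p ≤ (r : WithTop (ℕ × ℕ)) ∧ ¬ q ≤ (r : WithTop (ℕ × ℕ))}

theorem ordConnected_hook (p q : WithTop (ℕ × ℕ)) : (hook p q).OrdConnected := by
  refine ⟨fun a ha b hb c hc => ⟨ha.1.trans ?_, fun h => hb.2 (h.trans ?_)⟩⟩
  · exact WithTop.coe_le_coe.2 hc.1
  · exact WithTop.coe_le_coe.2 hc.2

/-- The degree `r` part of the interval module with support `I`, as a subspace of `F`: it is `F` for
`r ∈ I` and `0` otherwise. -/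
def intervalPart (F : Type u) [Field F] (I : Set (ℕ × ℕ)) (r : ℕ × ℕ) : Submodule F F where
  carrier := {a | r ∉ I → a = 0}
  add_mem' {a b} ha hb h := by rw [ha h, hb h, add_zero]
  zero_mem' _ := rfl
  smul_mem' c a ha h := by rw [ha h, smul_zero]

open Classical in
/-- The structure map of the interval module: the identity of `F` between degrees of `I`, and zero
otherwise. -/
def intervalMap (F : Type u) [Field F] (I : Set (ℕ × ℕ)) (r r' : ℕ × ℕ) :
    intervalPart F I r →ₗ[F] intervalPart F I r' where
  toFun a := ⟨if r' ∈ I then a.1 else 0, fun h => by simp [h]⟩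
  map_add' a b := by ext; by_cases h : r' ∈ I <;> simp [h]
  map_smul' c a := by ext; by_cases h : r' ∈ I <;> simp [h]

/-- The interval module with support a convex set `I`. -/
def intervalModule (F : Type u) [Field F] (I : Set (ℕ × ℕ)) (hI : I.OrdConnected) :
    PersistenceModule F (ℕ × ℕ) where
  obj r := ModuleCat.of F (intervalPart F I r)
  map {r r'} _ := ModuleCat.ofHom (intervalMap F I r r')
  map_id r := by
    ext ⟨a, ha⟩
    by_cases h : r ∈ I
    · simp [intervalMap, h]
    · simp [intervalMap, h, ha h]
  map_comp {r r' r''} h h' := by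
    ext ⟨a, ha⟩
    by_cases h1 : r ∈ I
    · by_cases h3 : r'' ∈ I
      · have h2 : r' ∈ I := hI.out h1 h3 ⟨h.le, h'.le⟩
        simp [intervalMap, h2, h3]
      · simp [intervalMap, h3]
    · simp [intervalMap, ha h1]

/-- The direct sum of a family of biparameter persistence modules. -/
def directSumModule {ι : Type u} (N : ι → (PersistenceModule F (ℕ × ℕ))) :
    PersistenceModule F (ℕ × ℕ) where
  obj r := ModuleCat.of F (DirectSum ι fun i => (N i).obj r)
  map {_ _} h := ModuleCat.ofHom (DirectSum.lmap fun i => ((N i).map h).hom)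
  map_id r := by
    simp only [CategoryTheory.Functor.map_id, ModuleCat.hom_id, DirectSum.lmap_id,
      ModuleCat.ofHom_id]
  map_comp {_ _ _} h h' := by
    simp only [CategoryTheory.Functor.map_comp, ModuleCat.hom_comp, DirectSum.lmap_comp,
      ModuleCat.ofHom_comp]

/-- A biparameter persistence module is hook-decomposable if it is isomorphic to a direct sum of
hook modules. -/
def IsHookDecomposable (B : PersistenceModule F (ℕ × ℕ)) : Prop :=
  ∃ (ι : Type u) (p q : ι → WithTop (ℕ × ℕ)), (∀ i, p i ≤ q i) ∧
    Nonempty (B ≅ directSumModule fun i =>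
      intervalModule F (hook (p i) (q i)) (ordConnected_hook (p i) (q i)))

end PersistenceProduct

end

open PersistenceProduct

noncomputable section

namespace PersistenceProduct

open AlgebraicTopology Limits

/-! ### Homology of an increasing union of subcomplexes. -/

section Homology

variable {F : Type u} [Field F]

/-! It suffices to find one bijection `γ` whose product is isomorphic to $M_{(f,g)}$. Then the
infimum of the distances is 0, so every minimizer has distance 0; as the distance is an infimum of
natural numbers it is attained, and a 0-interleaving is an isomorphism
(`interleavingDistance_eq_zero_iff`).

Singular chains have compact support and $g$ is bounded on compact sets, so $H_k\{f\le i\}$ is the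
colimit over $j$ of $H_k\{f\le i, g\le j\}$, and symmetrically in $g$ (`exhausts_persistenceModule`;
the order map `e` of `Exhausts` is the identity or the swap of coordinates, so one argument serves
both directions). Finite type leaves finitely many nonempty hooks. For $j$ large, the hook from
$p=(b,b')$ to $q=(d,d')$ restricts to the interval $[b,d)$; for large first coordinate, to
$[b',d')$. Hence the intervals $[b,d)$ form the barcode of $M_f$ and the $[b',d')$ that of $M_g$,
empty intervals being diagonal points (`Exhausts.structureRank_eq`, `exists_injective_diagram`).

Each hook thus picks a point of $PD_k(f)$ and one of $PD_k(g)$, not both diagonal because the hook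
is nonempty. All unused points are diagonal, and infinitely many remain on each side, so the partial
matching extends to a bijection (`exists_equiv_of_injective`). Its product has exactly one generator
per hook (`exists_iso_gammaProduct`). -/

theorem exists_homology_π (K : ChainComplex (ModuleCat.{u} F) ℕ) (k : ℕ) (x : K.homology k) :
    ∃ z : K.cycles k, K.homologyπ k z = x :=
  (ModuleCat.epi_iff_surjective _).1 inferInstance x

theorem exists_cycle_of_d_eq_zero (K : ChainComplex (ModuleCat.{u} F) ℕ) (k : ℕ) (x : K.X k)
    (hx : K.d k ((ComplexShape.down ℕ).next k) x = 0) : ∃ z : K.cycles k, K.iCycles k z = x :=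
  ⟨K.cyclesMk x _ rfl hx, K.i_cyclesMk x _ rfl hx⟩

theorem iCycles_injective (K : ChainComplex (ModuleCat.{u} F) ℕ) (k : ℕ) :
    Function.Injective (K.iCycles k) :=
  (ModuleCat.mono_iff_injective _).1 inferInstance

theorem homologyπ_eq_zero_iff (K : ChainComplex (ModuleCat.{u} F) ℕ) (k : ℕ) (z : K.cycles k) :
    K.homologyπ k z = 0 ↔ ∃ w : K.X ((ComplexShape.down ℕ).prev k),
      K.d ((ComplexShape.down ℕ).prev k) k w = K.iCycles k z := by
  have hex := (ShortComplex.moduleCat_exact_iff _).1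
    (ShortComplex.exact_of_g_is_cokernel (ShortComplex.mk _ _ (K.toCycles_comp_homologyπ _ k))
      (K.homologyIsCokernel _ k rfl))
  constructor
  · intro h
    obtain ⟨w, hw⟩ := hex z h
    refine ⟨w, ?_⟩
    rw [← hw]
    exact (congr($(K.toCycles_i ((ComplexShape.down ℕ).prev k) k) w)).symm
  · rintro ⟨w, hw⟩
    have h1 : K.toCycles _ k w = z := iCycles_injective K k <| by
      rw [← hw]
      exact congr($(K.toCycles_i ((ComplexShape.down ℕ).prev k) k) w)
    rw [← h1]
    exact congr($(K.toCycles_comp_homologyπ ((ComplexShape.down ℕ).prev k) k) w)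

variable {K L : ChainComplex (ModuleCat.{u} F) ℕ}

theorem hom_f_d_apply (φ : K ⟶ L) (i j : ℕ) (x : K.X i) :
    φ.f j (K.d i j x) = L.d i j (φ.f i x) :=
  (congr($(φ.comm i j) x)).symm

theorem iCycles_cyclesMap_apply (φ : K ⟶ L) (k : ℕ) (z : K.cycles k) :
    L.iCycles k (HomologicalComplex.cyclesMap φ k z) = φ.f k (K.iCycles k z) :=
  congr($(HomologicalComplex.cyclesMap_i φ k) z)

theorem homologyMap_π_apply (φ : K ⟶ L) (k : ℕ) (z : K.cycles k) :
    HomologicalComplex.homologyMap φ k (K.homologyπ k z) =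
      L.homologyπ k (HomologicalComplex.cyclesMap φ k z) :=
  congr($(HomologicalComplex.homologyπ_naturality φ k) z)

/-- A homology class represented by a cycle in the image of an injective chain map lifts. -/
theorem exists_homologyMap_eq (K : ℕ → ChainComplex (ModuleCat.{u} F) ℕ) (φ : ∀ j, K j ⟶ L)
    (hinj : ∀ j n, Function.Injective ((φ j).f n))
    (hsurj : ∀ n (x : L.X n), ∃ j, ∃ y : (K j).X n, (φ j).f n y = x) (k : ℕ) (x : L.homology k) :
    ∃ j, ∃ y : (K j).homology k, HomologicalComplex.homologyMap (φ j) k y = x := by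
  obtain ⟨z, rfl⟩ := exists_homology_π L k x
  obtain ⟨j, c, hc⟩ := hsurj k (L.iCycles k z)
  -- The boundary of `c` maps to the boundary of a cycle, so it vanishes by injectivity.
  obtain ⟨z', hz'⟩ := exists_cycle_of_d_eq_zero (K j) k c <| hinj j _ <| by
    rw [hom_f_d_apply, hc, map_zero]
    exact congr($(L.iCycles_d k ((ComplexShape.down ℕ).next k)) z)
  refine ⟨j, (K j).homologyπ k z', ?_⟩
  rw [homologyMap_π_apply]
  congr 1
  apply iCycles_injective
  rw [iCycles_cyclesMap_apply, hz', hc]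

/-- A chain that bounds the cycle in the union already lies in some stage; injectivity makes it
bound the cycle there. -/
theorem exists_homologyMap_eq_zero (K : ℕ → ChainComplex (ModuleCat.{u} F) ℕ) (φ : ∀ j, K j ⟶ L)
    (t : ∀ {j j'}, j ≤ j' → (K j ⟶ K j')) (ht : ∀ {j j'} (h : j ≤ j'), t h ≫ φ j' = φ j)
    (hinj : ∀ j n, Function.Injective ((φ j).f n))
    (hsurj : ∀ n (x : L.X n), ∃ j, ∃ y : (K j).X n, (φ j).f n y = x) (k j : ℕ)
    (x : (K j).homology k) (hx : HomologicalComplex.homologyMap (φ j) k x = 0) :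
    ∃ (j' : ℕ) (h : j ≤ j'), HomologicalComplex.homologyMap (t h) k x = 0 := by
  obtain ⟨z, rfl⟩ := exists_homology_π (K j) k x
  rw [homologyMap_π_apply, homologyπ_eq_zero_iff] at hx
  obtain ⟨w, hw⟩ := hx
  obtain ⟨l, y, rfl⟩ := hsurj _ w
  have h1 (n : ℕ) {a b : ℕ} (h : a ≤ b) (u : (K a).X n) :
      (φ b).f n ((t h).f n u) = (φ a).f n u := by
    rw [← ht h]; rfl
  refine ⟨max j l, le_max_left _ _, ?_⟩
  rw [homologyMap_π_apply, homologyπ_eq_zero_iff]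
  refine ⟨(t (le_max_right j l)).f _ y, hinj (max j l) _ ?_⟩
  rw [hom_f_d_apply, h1, hw, iCycles_cyclesMap_apply, iCycles_cyclesMap_apply, h1]

end Homology

/-! ### Compact supports of singular chains. -/

section SingularChains

variable (F : Type u) [Field F]

/-- The singular chain complex with coefficients in `F`. -/
abbrev singularChains (Y : TopCat.{u}) : ChainComplex (ModuleCat.{u} F) ℕ :=
  ((singularChainComplexFunctor (ModuleCat.{u} F)).obj (ModuleCat.of F F)).obj Y

/-- The chain map induced by a continuous map. -/
abbrev singularChainsMap {Y Z : TopCat.{u}} (φ : Y ⟶ Z) : singularChains F Y ⟶ singularChains F Z :=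
  ((singularChainComplexFunctor (ModuleCat.{u} F)).obj (ModuleCat.of F F)).map φ

theorem singularChainsMap_injective {Y Z : TopCat.{u}} (φ : Y ⟶ Z) (hφ : Function.Injective φ)
    (n : ℕ) : Function.Injective ((singularChainsMap F φ).f n) := by
  have : Mono φ := (TopCat.mono_iff_injective φ).2 hφ
  exact (ModuleCat.mono_iff_injective _).1 inferInstance

/-- The inclusion of the summand of a singular simplex. -/
def simplexChain (Y : TopCat.{u}) (n : ℕ)
    (σ : (TopCat.toSSet.obj Y).obj (Opposite.op (SimplexCategory.mk n))) :
    ModuleCat.of F F ⟶ (singularChains F Y).X n :=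
  Sigma.ι (fun _ : (TopCat.toSSet.obj Y).obj (Opposite.op (SimplexCategory.mk n)) =>
    ModuleCat.of F F) σ

theorem simplexChain_map {Y Z : TopCat.{u}} (φ : Y ⟶ Z) (n : ℕ)
    (σ : (TopCat.toSSet.obj Y).obj (Opposite.op (SimplexCategory.mk n))) :
    simplexChain F Y n σ ≫ (singularChainsMap F φ).f n =
      simplexChain F Z n ((TopCat.toSSet.map φ).app _ σ) := by
  refine (Sigma.ι_desc _ _).trans ?_
  simp only [Category.id_comp]
  rfl

/-- The chain module is an abstract coproduct, so induction on a direct sum is transported along the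
comparison isomorphism. -/
theorem chain_induction {Y : TopCat.{u}} {n : ℕ} (p : (singularChains F Y).X n → Prop)
    (h0 : p 0) (hadd : ∀ x y, p x → p y → p (x + y))
    (hι : ∀ σ a, p (simplexChain F Y n σ a)) (x : (singularChains F Y).X n) : p x := by
  classical
  let S := (TopCat.toSSet.obj Y).obj (Opposite.op (SimplexCategory.mk n))
  let e := ModuleCat.coprodIsoDirectSum (fun _ : S => ModuleCat.of F F)
  suffices h : ∀ y, p (e.inv y) by
    have := h (e.hom x)
    rwa [show e.inv (e.hom x) = x from congr($(e.hom_inv_id) x)] at this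
  intro y
  induction y using DirectSum.induction_on with
  | zero => exact (congrArg p (map_zero e.inv.hom)).mpr h0
  | of i a =>
    have h2 : e.inv (DirectSum.lof F S (fun _ => ModuleCat.of F F) i a) =
        simplexChain F Y n i a :=
      congr($(ModuleCat.lof_coprodIsoDirectSum_inv (fun _ : S => ModuleCat.of F F) i) a)
    exact (congrArg p h2).mpr (hι i a)
  | add a b ha hb => exact (congrArg p (map_add e.inv.hom a b)).mpr (hadd _ _ ha hb)

/-- A singular simplex whose compact image lies in an embedded subspace factors through it. -/
theorem exists_simplex_lift {Y : TopCat.{u}} {n : ℕ} (A : ℕ → TopCat.{u}) (φ : ∀ j, A j ⟶ Y)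
    (hemb : ∀ j, Topology.IsEmbedding (φ j))
    (hcpt : ∀ K : Set Y, IsCompact K → ∃ j, K ⊆ Set.range (φ j))
    (σ : (TopCat.toSSet.obj Y).obj (Opposite.op (SimplexCategory.mk n))) :
    ∃ j, ∃ τ, (TopCat.toSSet.map (φ j)).app (Opposite.op (SimplexCategory.mk n)) τ = σ := by
  let s : SimplexCategory.toTop.{u}.obj (SimplexCategory.mk n) ⟶ Y := σ.down
  have : CompactSpace (SimplexCategory.toTop.{u}.obj (SimplexCategory.mk n)) :=
    inferInstanceAs (CompactSpace (ULift (stdSimplex ℝ (Fin (n + 1)))))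
  obtain ⟨j, hj⟩ := hcpt (Set.range s) (isCompact_range s.hom.continuous)
  choose l hl using fun x => hj ⟨x, rfl⟩
  -- The set-theoretic lift is continuous because the stage carries the subspace topology.
  have hcont : Continuous l := (hemb j).continuous_iff.2 <| by
    convert s.hom.continuous
    exact funext hl
  refine ⟨j, ⟨TopCat.ofHom ⟨l, hcont⟩⟩, ?_⟩
  refine ULift.ext _ _ ?_
  exact TopCat.hom_ext (ContinuousMap.ext hl)

/-- A chain is a finite sum of simplices, each of which lifts to some stage; the largest of these
stages serves for all. -/
theorem exists_singularChainsMap_eq {Y : TopCat.{u}} (A : ℕ → TopCat.{u}) (φ : ∀ j, A j ⟶ Y)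
    (t : ∀ {j j'}, j ≤ j' → (A j ⟶ A j')) (ht : ∀ {j j'} (h : j ≤ j'), t h ≫ φ j' = φ j)
    (hemb : ∀ j, Topology.IsEmbedding (φ j))
    (hcpt : ∀ K : Set Y, IsCompact K → ∃ j, K ⊆ Set.range (φ j)) (n : ℕ)
    (x : (singularChains F Y).X n) :
    ∃ j, ∃ y, (singularChainsMap F (φ j)).f n y = x := by
  induction x using chain_induction with
  | h0 => exact ⟨0, 0, map_zero _⟩
  | hadd x y hx hy =>
    obtain ⟨j, x, rfl⟩ := hx
    obtain ⟨l, y, rfl⟩ := hy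
    have h1 {a b : ℕ} (h : a ≤ b) (u : (singularChains F (A a)).X n) :
        (singularChainsMap F (φ b)).f n ((singularChainsMap F (t h)).f n u) =
          (singularChainsMap F (φ a)).f n u := by
      rw [← ht h, singularChainsMap, singularChainsMap, singularChainsMap, Functor.map_comp]
      rfl
    refine ⟨max j l, (singularChainsMap F (t (le_max_left j l))).f n x +
      (singularChainsMap F (t (le_max_right j l))).f n y, ?_⟩
    rw [map_add, h1, h1]
  | hι σ a =>
    obtain ⟨j, τ, rfl⟩ := exists_simplex_lift A φ hemb hcpt σ
    exact ⟨j, simplexChain F (A j) n τ a, congr($(simplexChain_map F (φ j) n τ) a)⟩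

/-- Singular homology with coefficients in `F`. -/
abbrev singularHomology (k : ℕ) : TopCat.{u} ⥤ ModuleCat.{u} F :=
  (singularHomologyFunctor (ModuleCat.{u} F) k).obj (ModuleCat.of F F)

/-- Every singular homology class is supported in some stage of a compactly exhausting sequence of
subspaces. -/
theorem exists_singularHomology_map_eq {Y : TopCat.{u}} (A : ℕ → TopCat.{u}) (φ : ∀ j, A j ⟶ Y)
    (t : ∀ {j j'}, j ≤ j' → (A j ⟶ A j')) (ht : ∀ {j j'} (h : j ≤ j'), t h ≫ φ j' = φ j)
    (hemb : ∀ j, Topology.IsEmbedding (φ j))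
    (hcpt : ∀ K : Set Y, IsCompact K → ∃ j, K ⊆ Set.range (φ j)) (k : ℕ)
    (x : (singularHomology F k).obj Y) :
    ∃ j, ∃ y, (singularHomology F k).map (φ j) y = x :=
  exists_homologyMap_eq (fun j => singularChains F (A j)) (fun j => singularChainsMap F (φ j))
    (fun j n => singularChainsMap_injective F (φ j) (hemb j).injective n)
    (exists_singularChainsMap_eq F A φ t ht hemb hcpt) k x

/-- A singular homology class that dies in the union of a compactly exhausting sequence of
subspaces dies at some stage. -/
theorem exists_singularHomology_map_eq_zero {Y : TopCat.{u}} (A : ℕ → TopCat.{u})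
    (φ : ∀ j, A j ⟶ Y)
    (t : ∀ {j j'}, j ≤ j' → (A j ⟶ A j')) (ht : ∀ {j j'} (h : j ≤ j'), t h ≫ φ j' = φ j)
    (hemb : ∀ j, Topology.IsEmbedding (φ j))
    (hcpt : ∀ K : Set Y, IsCompact K → ∃ j, K ⊆ Set.range (φ j)) (k j : ℕ)
    (x : (singularHomology F k).obj (A j)) (hx : (singularHomology F k).map (φ j) x = 0) :
    ∃ (j' : ℕ) (h : j ≤ j'), (singularHomology F k).map (t h) x = 0 :=
  exists_homologyMap_eq_zero (fun j => singularChains F (A j)) (fun j => singularChainsMap F (φ j))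
    (fun h => singularChainsMap F (t h))
    (fun h => by rw [singularChainsMap, singularChainsMap, ← Functor.map_comp, ht])
    (fun j n => singularChainsMap_injective F (φ j) (hemb j).injective n)
    (exists_singularChainsMap_eq F A φ t ht hemb hcpt) k j x hx

end SingularChains

/-! ### Modules presented by one monomial relation per generator. -/

section Presented

variable {F : Type u} [Field F] {S : Type} {birth : S → ℕ × ℕ} {death : S → ℕ∞ × ℕ∞}

/-- The generator `s` is nonzero in bidegree `r`. -/
def Alive (birth : S → ℕ × ℕ) (death : S → ℕ∞ × ℕ∞) (s : S) (r : ℕ × ℕ) : Prop :=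
  birth s ≤ r ∧ ¬ ((death s).1 ≤ (r.1 : ℕ∞) ∧ (death s).2 ≤ (r.2 : ℕ∞))

variable (F birth death) in
/-- The part of bidegree `r` of a presented module. -/
abbrev PresentedPart (r : ℕ × ℕ) : Type u := FreePart F birth r ⧸ relations F birth death r

variable (F birth death) in
/-- The structure maps of a presented module. -/
abbrev presentedMap {r r' : ℕ × ℕ} (h : r ≤ r') :
    PresentedPart F birth death r →ₗ[F] PresentedPart F birth death r' :=
  Submodule.mapQ _ _ (freeMap F birth h) (relations_le_comap F birth death h)

variable (F death) in
/-- The multiple in bidegree `r` of the generator `s` of a presented module. -/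
def generator {s : S} {r : ℕ × ℕ} (h : birth s ≤ r) : PresentedPart F birth death r :=
  (relations F birth death r).mkQ (Finsupp.single ⟨s, h⟩ 1)

theorem generator_eq_zero {s : S} {r : ℕ × ℕ} (h : birth s ≤ r) (h' : ¬ Alive birth death s r) :
    generator F death h = 0 := by
  have h2 : (death s).1 ≤ (r.1 : ℕ∞) ∧ (death s).2 ≤ (r.2 : ℕ∞) := by
    by_contra h2
    exact h' ⟨h, h2⟩
  exact (Submodule.Quotient.mk_eq_zero _).2 (Submodule.subset_span ⟨⟨s, h⟩, h2.1, h2.2, rfl⟩)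

theorem presentedMap_generator {s : S} {r r' : ℕ × ℕ} (h : birth s ≤ r) (hr : r ≤ r') :
    presentedMap F birth death hr (generator F death h) = generator F death (h.trans hr) := by
  simp [generator, freeMap, Finsupp.lmapDomain_apply, Finsupp.mapDomain_single]

theorem presentedPart_induction {r : ℕ × ℕ} {p : PresentedPart F birth death r → Prop}
    (zero : p 0) (add : ∀ x y, p x → p y → p (x + y))
    (smul : ∀ (s : S) (h : Alive birth death s r) (a : F), p (a • generator F death h.1))
    (x : PresentedPart F birth death r) : p x := by
  obtain ⟨w, rfl⟩ := (relations F birth death r).mkQ_surjective x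
  induction w using Finsupp.induction_linear with
  | zero => rwa [map_zero]
  | add v w hv hw => rw [map_add]; exact add _ _ hv hw
  | single s a =>
    have h1 : (relations F birth death r).mkQ (Finsupp.single s a) =
        a • generator F death s.2 := by
      rw [generator, ← map_smul, Finsupp.smul_single, smul_eq_mul, mul_one]
    rw [h1]
    by_cases h : Alive birth death s.1 r
    · exact smul s.1 h a
    · rwa [generator_eq_zero s.2 h, smul_zero]

/-- The coefficient of the generator `s` in bidegree `r`, if that generator is nonzero there. -/
def coefficient {s : S} {r : ℕ × ℕ} (h : Alive birth death s r) :
    PresentedPart F birth death r →ₗ[F] F :=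
  (relations F birth death r).liftQ (Finsupp.lapply ⟨s, h.1⟩) <| Submodule.span_le.2 <| by
    rintro _ ⟨t, h1, h2, rfl⟩
    refine Finsupp.single_eq_of_ne ?_
    rintro rfl
    exact h.2 ⟨h1, h2⟩

theorem coefficient_generator_self {s : S} {r : ℕ × ℕ} (h : Alive birth death s r) :
    coefficient h (generator F death h.1) = 1 :=
  (Submodule.liftQ_apply _ _ _).trans Finsupp.single_eq_same

theorem coefficient_generator_of_ne {s t : S} {r : ℕ × ℕ} (h : Alive birth death s r)
    (ht : birth t ≤ r) (hst : t ≠ s) : coefficient h (generator F death ht) = 0 :=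
  (Submodule.liftQ_apply _ _ _).trans <|
    Finsupp.single_eq_of_ne fun h => hst (congrArg Subtype.val h).symm

/-- The relations are spanned by basis vectors, so in each bidegree the alive generators form a
basis of the quotient, with these coefficients as coordinates. -/
theorem eq_zero_of_coefficient_eq_zero {r : ℕ × ℕ} (x : PresentedPart F birth death r)
    (hx : ∀ (s : S) (h : Alive birth death s r), coefficient h x = 0) : x = 0 := by
  obtain ⟨w, rfl⟩ := (relations F birth death r).mkQ_surjective x
  refine (Submodule.Quotient.mk_eq_zero _).2 ?_
  rw [← Finsupp.sum_single w]
  refine Submodule.sum_mem _ fun s hs => ?_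
  by_cases h : Alive birth death s.1 r
  · exact absurd (hx s.1 h) (Finsupp.mem_support_iff.1 hs)
  · have h1 : Finsupp.single s (w s) = w s • Finsupp.single s (1 : F) := by simp
    rw [h1]
    exact Submodule.smul_mem _ _ ((Submodule.Quotient.mk_eq_zero _).1 (generator_eq_zero s.2 h))

theorem coefficient_presentedMap {s : S} {r r' : ℕ × ℕ} (hr : r ≤ r') (h : Alive birth death s r)
    (h' : Alive birth death s r') (x : PresentedPart F birth death r) :
    coefficient h' (presentedMap F birth death hr x) = coefficient h x := by
  induction x using presentedPart_induction with
  | zero => simp only [map_zero]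
  | add x y hx hy => simp only [map_add, hx, hy]
  | smul t ht a =>
    rw [map_smul, map_smul, map_smul, presentedMap_generator]
    by_cases hts : t = s
    · subst hts
      rw [coefficient_generator_self, coefficient_generator_self]
    · rw [coefficient_generator_of_ne h _ hts, coefficient_generator_of_ne h' _ hts]

theorem linearIndependent_generator {r : ℕ × ℕ} (A : Set S) (hA : ∀ s ∈ A, Alive birth death s r) :
    LinearIndependent F fun s : A => generator F death (hA s.1 s.2).1 := by
  rw [linearIndependent_iff']
  intro T c hc s hs
  have h1 := congrArg (coefficient (hA s.1 s.2)) hc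
  rw [map_sum, map_zero, Finset.sum_eq_single s, map_smul, coefficient_generator_self,
    smul_eq_mul, mul_one] at h1
  · exact h1
  · intro t _ hts
    rw [map_smul, coefficient_generator_of_ne _ _ fun h => hts (Subtype.ext h), smul_zero]
  · exact fun h => absurd hs h

/-- The generators alive in both degrees form a basis of the range; all others are sent to 0 or are
not yet alive. -/
theorem finrank_range_presentedMap [Finite S] {r r' : ℕ × ℕ} (hr : r ≤ r') :
    Module.finrank F (LinearMap.range (presentedMap F birth death hr)) =
      {s | Alive birth death s r ∧ Alive birth death s r'}.ncard := by
  classical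
  have := Fintype.ofFinite S
  set A := {s | Alive birth death s r ∧ Alive birth death s r'} with hA
  have h1 : LinearMap.range (presentedMap F birth death hr) =
      Submodule.span F (Set.range fun s : A => generator F death (s.2.2.1 : birth s.1 ≤ r')) := by
    apply le_antisymm
    · rintro _ ⟨x, rfl⟩
      induction x using presentedPart_induction with
      | zero => rw [map_zero]; exact zero_mem _
      | add x y hx hy => rw [map_add]; exact add_mem hx hy
      | smul s h a =>
        rw [map_smul, presentedMap_generator]
        refine Submodule.smul_mem _ _ ?_
        by_cases h' : Alive birth death s r'
        · exact Submodule.subset_span ⟨⟨s, h, h'⟩, rfl⟩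
        · rw [generator_eq_zero _ h']; exact zero_mem _
    · refine Submodule.span_le.2 ?_
      rintro _ ⟨s, rfl⟩
      exact ⟨generator F death s.2.1.1, presentedMap_generator _ _⟩
  rw [h1, finrank_span_eq_card (linearIndependent_generator A fun s hs => hs.2),
    ← Nat.card_eq_fintype_card, Nat.card_coe_set_eq]

/-- A structure map is bijective if the same generators are nonzero in both degrees. -/
theorem presentedMap_bijective {r r' : ℕ × ℕ} (hr : r ≤ r')
    (h : ∀ s, Alive birth death s r ↔ Alive birth death s r') :
    Function.Bijective (presentedMap F birth death hr) := by
  constructor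
  · refine (injective_iff_map_eq_zero _).2 fun x hx =>
      eq_zero_of_coefficient_eq_zero x fun s hs => ?_
    rw [← coefficient_presentedMap hr hs ((h s).1 hs), hx, map_zero]
  · intro y
    induction y using presentedPart_induction with
    | zero => exact ⟨0, map_zero _⟩
    | add x y hx hy =>
      obtain ⟨x, rfl⟩ := hx
      obtain ⟨y, rfl⟩ := hy
      exact ⟨x + y, map_add _ _ _⟩
    | smul s hs a =>
      exact ⟨a • generator F death ((h s).2 hs).1, by rw [map_smul, presentedMap_generator]⟩

end Presented

/-! ### Presented modules as direct sums of interval modules. -/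

section Decomposition

variable {F : Type u} [Field F] {S : Type} {birth : S → ℕ × ℕ} {death : S → ℕ∞ × ℕ∞}
  {ι : Type u} {I : ι → Set (ℕ × ℕ)}

open Classical in
/-- The element of the interval module in degree `r` that is `1` if `r` lies in the interval. -/
def intervalOne (F : Type u) [Field F] (I : Set (ℕ × ℕ)) (r : ℕ × ℕ) : intervalPart F I r :=
  ⟨if r ∈ I then 1 else 0, fun h => if_neg h⟩

theorem intervalPart_eq_smul (I : Set (ℕ × ℕ)) (r : ℕ × ℕ) (a : intervalPart F I r) :
    a = a.1 • intervalOne F I r := by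
  ext
  by_cases h : r ∈ I
  · simp [intervalOne, h]
  · simp [intervalOne, h, a.2 h]

theorem intervalMap_intervalOne (I : Set (ℕ × ℕ)) (r r' : ℕ × ℕ) (h : r' ∈ I → r ∈ I) :
    intervalMap F I r r' (intervalOne F I r) = intervalOne F I r' := by
  ext
  by_cases h' : r' ∈ I
  · simp [intervalOne, intervalMap, h', h h']
  · simp [intervalOne, intervalMap, h']

theorem intervalOne_eq_zero {I : Set (ℕ × ℕ)} {r : ℕ × ℕ} (h : r ∉ I) : intervalOne F I r = 0 := by
  ext
  simp [intervalOne, h]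

variable (F I) in
open Classical in
/-- The summand of index `i` of the direct sum of interval modules is generated by this element. -/
def summandOne (r : ℕ × ℕ) (i : ι) : DirectSum ι fun i => intervalPart F (I i) r :=
  DirectSum.lof F ι (fun i => intervalPart F (I i) r) i (intervalOne F (I i) r)

theorem lmap_summandOne (r r' : ℕ × ℕ) (i : ι) (h : r' ∈ I i → r ∈ I i) :
    DirectSum.lmap (fun i => intervalMap F (I i) r r') (summandOne F I r i) =
      summandOne F I r' i := by
  rw [summandOne, DirectSum.lmap_lof, intervalMap_intervalOne _ _ _ h, summandOne]

theorem summandOne_eq_zero {r : ℕ × ℕ} {i : ι} (h : r ∉ I i) : summandOne F I r i = 0 := by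
  rw [summandOne, intervalOne_eq_zero h, map_zero]

theorem summandOne_apply_self {r : ℕ × ℕ} {i : ι} (h : r ∈ I i) :
    (summandOne F I r i i).1 = 1 := by
  classical
  rw [summandOne, DirectSum.lof_eq_of, DirectSum.of_eq_same]
  simp [intervalOne, h]

theorem summandOne_apply_of_ne {r : ℕ × ℕ} {i j : ι} (h : j ≠ i) :
    summandOne F I r j i = 0 := by
  classical
  rw [summandOne, DirectSum.lof_eq_of, DirectSum.of_eq_of_ne _ _ _ h.symm]

variable {e : S → ι} (he : ∀ s, I (e s) = {r | Alive birth death s r})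

/-- In bidegree `r`, the map to a direct sum of interval modules that sends the generator `s` to the
generator of the interval module with index `e s`. -/
def toSummands (r : ℕ × ℕ) :
    PresentedPart F birth death r →ₗ[F] DirectSum ι fun i => intervalPart F (I i) r :=
  (relations F birth death r).liftQ
    (Finsupp.linearCombination F fun s => summandOne F I r (e s.1)) <|
    Submodule.span_le.2 <| by
      rintro _ ⟨t, h1, h2, rfl⟩
      have h : r ∉ I (e t.1) := by
        rw [he]
        exact fun h => h.2 ⟨h1, h2⟩
      simp [summandOne_eq_zero h]

theorem toSummands_generator {s : S} {r : ℕ × ℕ} (h : birth s ≤ r) :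
    toSummands (F := F) he r (generator F death h) = summandOne F I r (e s) :=
  (Submodule.liftQ_apply _ _ _).trans (by simp)

theorem toSummands_presentedMap {r r' : ℕ × ℕ} (hr : r ≤ r') (x : PresentedPart F birth death r) :
    toSummands he r' (presentedMap F birth death hr x) =
      DirectSum.lmap (fun i => intervalMap F (I i) r r') (toSummands he r x) := by
  induction x using presentedPart_induction with
  | zero => simp only [map_zero]
  | add x y hx hy => simp only [map_add, hx, hy]
  | smul s h a =>
    rw [map_smul, map_smul, map_smul, map_smul, presentedMap_generator, toSummands_generator,
      toSummands_generator, lmap_summandOne]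
    intro _
    rw [he]
    exact h

/-- Injectivity of `e` keeps two generators from landing in the same summand. -/
theorem toSummands_apply (hinj : Function.Injective e) {r : ℕ × ℕ} {s : S}
    (h : Alive birth death s r) (x : PresentedPart F birth death r) :
    (toSummands he r x (e s)).1 = coefficient h x := by
  induction x using presentedPart_induction with
  | zero => simp
  | add x y hx hy => simp only [map_add, ← hx, ← hy]; rfl
  | smul t ht a =>
    rw [map_smul, map_smul, toSummands_generator, DirectSum.smul_apply]
    by_cases hts : t = s
    · subst hts
      have h1 : r ∈ I (e t) := by
        rw [he]
        exact h
      rw [coefficient_generator_self, Submodule.coe_smul, summandOne_apply_self h1]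
    · rw [coefficient_generator_of_ne _ _ hts, summandOne_apply_of_ne (hinj.ne hts), smul_zero,
        smul_zero, Submodule.coe_zero]

theorem toSummands_bijective (hinj : Function.Injective e)
    (hI : ∀ i, i ∉ Set.range e → I i = ∅) (r : ℕ × ℕ) :
    Function.Bijective (toSummands (F := F) he r) := by
  classical
  constructor
  · refine (injective_iff_map_eq_zero _).2 fun x hx =>
      eq_zero_of_coefficient_eq_zero x fun s hs => ?_
    rw [← toSummands_apply he hinj hs, hx]
    rfl
  · intro y
    induction y using DirectSum.induction_on with
    | zero => exact ⟨0, map_zero _⟩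
    | add x y hx hy =>
      obtain ⟨x, rfl⟩ := hx
      obtain ⟨y, rfl⟩ := hy
      exact ⟨x + y, map_add _ _ _⟩
    | of i a =>
      by_cases hr : r ∈ I i
      · obtain ⟨s, rfl⟩ : i ∈ Set.range e := by
          by_contra hi
          rw [hI i hi] at hr
          exact hr
        have h : Alive birth death s r := by
          rw [he] at hr
          exact hr
        refine ⟨a.1 • generator F death h.1, ?_⟩
        rw [map_smul, toSummands_generator, summandOne, ← map_smul, ← intervalPart_eq_smul,
          DirectSum.lof_eq_of]
      · refine ⟨0, ?_⟩
        rw [show a = 0 from Subtype.ext (a.2 hr), map_zero, map_zero]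

/-- A module presented by generators with one monomial relation each is the direct sum of the
interval modules supported on the degrees in which the generators are nonzero. -/
def presentedModuleIso (hI : ∀ i, (I i).OrdConnected) (hinj : Function.Injective e)
    (hempty : ∀ i, i ∉ Set.range e → I i = ∅) :
    presentedModule F birth death ≅ directSumModule fun i => intervalModule F (I i) (hI i) :=
  NatIso.ofComponents
    (fun r => (LinearEquiv.ofBijective (toSummands (F := F) he r)
      (toSummands_bijective he hinj hempty r)).toModuleIso)
    (fun hr => ModuleCat.hom_ext (LinearMap.ext (toSummands_presentedMap he hr.le)))

/-- A direct sum of interval modules of finite type has finitely many nonzero summands. -/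
theorem finite_nonempty_of_isFiniteType (hI : ∀ i, (I i).OrdConnected)
    {B : PersistenceModule F (ℕ × ℕ)} (hB : IsFiniteType B)
    (iso : B ≅ directSumModule fun i => intervalModule F (I i) (hI i)) :
    {i | (I i).Nonempty}.Finite := by
  classical
  obtain ⟨n, deg, v, hv⟩ := hB
  let w (m : Fin n) : DirectSum ι fun i => intervalPart F (I i) (deg m) :=
    (iso.hom.app (deg m)).hom (v m)
  -- Only summands met by the finitely many generators can be nonzero: otherwise the projection `c`
  -- kills a spanning set, yet takes the value 1 in a degree of the interval.
  refine (Finset.univ.biUnion fun m => DFinsupp.support (w m)).finite_toSet.subset ?_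
  rintro i ⟨r, hr⟩
  by_contra hi
  have hw (m : Fin n) : w m i = 0 := by
    by_contra h
    exact hi (Finset.mem_coe.2 (Finset.mem_biUnion.2
      ⟨m, Finset.mem_univ _, DFinsupp.mem_support_iff.2 h⟩))
  let c : B.obj r →ₗ[F] intervalPart F (I i) r :=
    DirectSum.component F ι (fun i => intervalPart F (I i) r) i ∘ₗ (iso.hom.app r).hom
  have hc : c = 0 := by
    refine LinearMap.ext_on (hv r) ?_
    rintro _ ⟨m, h, rfl⟩
    have h1 : (iso.hom.app r).hom ((B.map (homOfLE h)).hom (v m)) =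
        DirectSum.lmap (fun i => intervalMap F (I i) (deg m) r) (w m) :=
      congr($(iso.hom.naturality (homOfLE h)) (v m))
    have h2 : DirectSum.lmap (fun i => intervalMap F (I i) (deg m) r) (w m) i =
      intervalMap F (I i) (deg m) r (w m i) := rfl
    change (show DirectSum ι fun i => intervalPart F (I i) r from
      (iso.hom.app r).hom ((B.map (homOfLE h)).hom (v m))) i = 0
    rw [h1]
    exact h2.trans (by rw [hw, map_zero])
  have h3 : c ((iso.inv.app r).hom (summandOne F I r i)) = summandOne F I r i i :=
    congrArg (fun y : DirectSum ι fun i => intervalPart F (I i) r => y i)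
      congr($(iso.inv_hom_id_app r) (summandOne F I r i))
  rw [hc] at h3
  exact one_ne_zero (α := F) ((summandOne_apply_self hr).symm.trans (congrArg Subtype.val h3.symm))

end Decomposition

/-! ### Colimits along one parameter. -/

section Exhaustion

variable {F : Type u} [Field F]

/-- The module `M` is the colimit of `B` in the second variable, after the change of variables `e`
of the bidegrees. -/
structure Exhausts (B : PersistenceModule F (ℕ × ℕ)) (M : PersistenceModule F ℕ)
    (e : ℕ × ℕ →o ℕ × ℕ) where
  /-- The maps to the colimit. -/
  toColimit : ∀ r : ℕ × ℕ, B.obj (e r) →ₗ[F] M.obj r.1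
  naturality : ∀ (r r' : ℕ × ℕ) (h : r ≤ r') (x : B.obj (e r)),
    toColimit r' ((B.map (homOfLE (e.monotone.imp h))).hom x) =
      (M.map (homOfLE h.1)).hom (toColimit r x)
  surj : ∀ (i : ℕ) (x : M.obj i), ∃ j y, toColimit (i, j) y = x
  ker : ∀ (i j : ℕ) (x : B.obj (e (i, j))), toColimit (i, j) x = 0 →
    ∃ (j' : ℕ) (h : j ≤ j'),
      (B.map (homOfLE (e.monotone.imp (show (i, j) ≤ (i, j') from ⟨le_rfl, h⟩)))).hom x = 0

/-- The property of being a colimit is invariant under isomorphisms. -/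
def Exhausts.ofIso {B B' : PersistenceModule F (ℕ × ℕ)} {M : PersistenceModule F ℕ}
    {e : ℕ × ℕ →o ℕ × ℕ} (E : Exhausts B M e) (iso : B' ≅ B) : Exhausts B' M e where
  toColimit r := E.toColimit r ∘ₗ (iso.hom.app (e r)).hom
  naturality r r' h x := by
    rw [LinearMap.comp_apply, LinearMap.comp_apply, ← E.naturality _ _ h]
    exact congrArg _ congr($(iso.hom.naturality (homOfLE (e.monotone.imp h))) x)
  surj i x := by
    obtain ⟨j, y, rfl⟩ := E.surj i x
    exact ⟨j, (iso.inv.app _).hom y, congrArg _ congr($(iso.inv_hom_id_app (e (i, j))) y)⟩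
  ker i j x hx := by
    obtain ⟨j', h, h0⟩ := E.ker i j _ hx
    refine ⟨j', h, ?_⟩
    set hr := homOfLE (e.monotone.imp (show (i, j) ≤ (i, j') from ⟨le_rfl, h⟩))
    have h1 : (iso.hom.app _).hom ((B'.map hr).hom x) = 0 :=
      (congr($(iso.hom.naturality hr) x)).trans h0
    have h2 : (iso.inv.app _).hom ((iso.hom.app _).hom ((B'.map hr).hom x)) = (B'.map hr).hom x :=
      congr($(iso.hom_inv_id_app _) ((B'.map hr).hom x))
    rw [← h2, h1, map_zero]

section Sublevel

variable {X : Type u} [TopologicalSpace X] {f g : X → ℕ} {φ : X → ℕ × ℕ} {e : ℕ × ℕ →o ℕ × ℕ}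
  (he : ∀ x i j, φ x ≤ e (i, j) ↔ f x ≤ i ∧ g x ≤ j)

/-- The inclusion of a sublevel set of a pair of functions in a sublevel set of the first one. -/
def sublevelInclusion (r : ℕ × ℕ) :
    (sublevelFiltration φ).obj (e r) ⟶ (sublevelFiltration f).obj r.1 :=
  TopCat.ofHom ⟨fun x : {x : X // φ x ≤ e r} =>
      (⟨x.1, ((he x.1 r.1 r.2).1 x.2).1⟩ : {x // f x ≤ r.1}),
    continuous_subtype_val.subtype_mk _⟩

theorem map_comp_sublevelInclusion {r r' : ℕ × ℕ} (h : r ≤ r') :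
    (sublevelFiltration φ).map (homOfLE (e.monotone.imp h)) ≫ sublevelInclusion he r' =
      sublevelInclusion he r ≫ (sublevelFiltration f).map (homOfLE h.1) :=
  TopCat.hom_ext (ContinuousMap.ext fun _ => rfl)

theorem isEmbedding_sublevelInclusion (r : ℕ × ℕ) :
    Topology.IsEmbedding (sublevelInclusion he r) :=
  Topology.IsEmbedding.of_comp (sublevelInclusion he r).hom.continuous
    (continuous_subtype_val (p := fun x => f x ≤ r.1)) Topology.IsEmbedding.subtypeVal

/-- This is where boundedness on compact sets enters: a bound of `g` on `K` is the required stage.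
-/
theorem exists_subset_range_sublevelInclusion (hg : ∀ K : Set X, IsCompact K → BddAbove (g '' K))
    (i : ℕ) (K : Set ((sublevelFiltration f).obj i)) (hK : IsCompact K) :
    ∃ j, K ⊆ Set.range (sublevelInclusion he (i, j)) := by
  obtain ⟨j, hj⟩ := hg _ (hK.image (continuous_subtype_val (p := fun x => f x ≤ i)))
  exact ⟨j, fun x hx => ⟨⟨x.1, (he _ _ _).2 ⟨x.2, hj ⟨_, ⟨x, hx, rfl⟩, rfl⟩⟩⟩, rfl⟩⟩

/-- The map of a sublevel filtration in the second variable. -/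
abbrev sublevelStep (φ : X → ℕ × ℕ) (e : ℕ × ℕ →o ℕ × ℕ) (i : ℕ) {j j' : ℕ} (h : j ≤ j') :
    (sublevelFiltration φ).obj (e (i, j)) ⟶ (sublevelFiltration φ).obj (e (i, j')) :=
  (sublevelFiltration φ).map (homOfLE (e.monotone.imp (show (i, j) ≤ (i, j') from ⟨le_rfl, h⟩)))

theorem sublevelStep_comp_sublevelInclusion (i : ℕ) {j j' : ℕ} (h : j ≤ j') :
    sublevelStep φ e i h ≫ sublevelInclusion he (i, j') = sublevelInclusion he (i, j) :=
  TopCat.hom_ext (ContinuousMap.ext fun _ => rfl)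

/-- The homology of the sublevel sets of one function is the colimit of the homology of their
intersections with the sublevel sets of another function that is bounded on compact sets. -/
def exhausts_persistenceModule (k : ℕ) (hg : ∀ K : Set X, IsCompact K → BddAbove (g '' K)) :
    Exhausts (persistenceModule F k φ) (persistenceModule F k f) e where
  toColimit r := ((singularHomology F k).map (sublevelInclusion he r)).hom
  naturality r r' h x := by
    have h2 := congrArg (singularHomology F k).map (map_comp_sublevelInclusion he h)
    rw [Functor.map_comp, Functor.map_comp] at h2
    exact congr($h2 x)
  surj i x :=
    exists_singularHomology_map_eq F (Y := (sublevelFiltration f).obj i)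
      (fun j => (sublevelFiltration φ).obj (e (i, j)))
      (fun j => sublevelInclusion he (i, j)) (sublevelStep φ e i)
      (sublevelStep_comp_sublevelInclusion he i) (fun j => isEmbedding_sublevelInclusion he (i, j))
      (exists_subset_range_sublevelInclusion he hg i) k x
  ker i j x hx :=
    exists_singularHomology_map_eq_zero F (Y := (sublevelFiltration f).obj i)
      (fun j => (sublevelFiltration φ).obj (e (i, j)))
      (fun j => sublevelInclusion he (i, j)) (sublevelStep φ e i)
      (sublevelStep_comp_sublevelInclusion he i) (fun j => isEmbedding_sublevelInclusion he (i, j))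
      (exists_subset_range_sublevelInclusion he hg i) k j x hx

end Sublevel

variable {S : Type} {birth : S → ℕ × ℕ} {death : S → ℕ∞ × ℕ∞}

/-- By `hJ`, aliveness no longer depends on the second index from `J` on, so the structure maps are
bijective there and the colimit is reached at stage `J`. -/
theorem Exhausts.bijective_toColimit {M : PersistenceModule F ℕ} {e : ℕ × ℕ →o ℕ × ℕ}
    (E : Exhausts (presentedModule F birth death) M e) {b : S → ℕ} {d : S → ℕ∞} {J : ℕ}
    (hJ : ∀ j, J ≤ j → ∀ s i, Alive birth death s (e (i, j)) ↔ b s ≤ i ∧ (i : ℕ∞) < d s) (i : ℕ) :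
    Function.Bijective (E.toColimit (i, J)) := by
  have hb {j : ℕ} (h : J ≤ j) :
      Function.Bijective ((presentedModule F birth death).map
        (homOfLE (e.monotone.imp (show (i, J) ≤ (i, j) from ⟨le_rfl, h⟩)))).hom :=
    presentedMap_bijective _ fun s => (hJ J le_rfl s i).trans (hJ j h s i).symm
  constructor
  · refine (injective_iff_map_eq_zero _).2 fun x hx => ?_
    obtain ⟨j, h, h0⟩ := E.ker i J x hx
    exact (injective_iff_map_eq_zero _).1 (hb h).1 x h0
  · intro x
    obtain ⟨j, y, rfl⟩ := E.surj i x
    have h1 := E.naturality (i, j) (i, max J j) ⟨le_rfl, le_max_right _ _⟩ y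
    obtain ⟨z, hz⟩ := (hb (le_max_left J j)).2 (((presentedModule F birth death).map
      (homOfLE (e.monotone.imp (show (i, j) ≤ (i, max J j) from ⟨le_rfl, le_max_right _ _⟩)))).hom y)
    have h2 := E.naturality (i, J) (i, max J j) ⟨le_rfl, le_max_left _ _⟩ z
    refine ⟨z, ?_⟩
    -- Naturality along a step in the second index leaves the structure map of `M` from `i` to `i`,
    -- which is the identity.
    have h3 (u : M.obj i) : (M.map (homOfLE (le_refl i))).hom u = u :=
      congr($(M.map_id i) u)
    exact (h3 _).symm.trans (h2.symm.trans ((congrArg _ hz).trans (h1.trans (h3 _))))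

/-- The rank is computed at level `J`, where it counts the generators alive at both `a` and `c`. -/
theorem Exhausts.structureRank_eq [Finite S] {M : PersistenceModule F ℕ} {e : ℕ × ℕ →o ℕ × ℕ}
    (E : Exhausts (presentedModule F birth death) M e) {b : S → ℕ} {d : S → ℕ∞} {J : ℕ}
    (hJ : ∀ j, J ≤ j → ∀ s i, Alive birth death s (e (i, j)) ↔ b s ≤ i ∧ (i : ℕ∞) < d s)
    {a c : ℕ} (hac : a ≤ c) :
    structureRank M a c = {s | b s ≤ a ∧ (c : ℕ∞) < d s}.ncard := by
  have hle : (a, J) ≤ (c, J) := ⟨hac, le_rfl⟩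
  have h1 : LinearMap.range (M.map (homOfLE hac)).hom =
      (LinearMap.range (presentedMap F birth death (e.monotone.imp hle))).map (E.toColimit (c, J)) := by
    refine ((LinearMap.range_comp_of_range_eq_top (f := E.toColimit (a, J)) _
      (LinearMap.range_eq_top.2 (E.bijective_toColimit hJ a).2)).symm.trans ?_).trans
        (LinearMap.range_comp (presentedMap F birth death (e.monotone.imp hle))
          (E.toColimit (c, J)))
    exact congrArg LinearMap.range (LinearMap.ext fun x => (E.naturality _ _ hle x).symm)
  rw [structureRank, dif_pos hac, h1]
  have h2 := (Submodule.equivMapOfInjective (E.toColimit (c, J)) (E.bijective_toColimit hJ c).1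
    (LinearMap.range ((presentedModule F birth death).map
      (homOfLE (e.monotone.imp hle))).hom)).finrank_eq
  refine (h2.symm.trans (finrank_range_presentedMap _)).trans
    (congrArg Set.ncard (Set.ext fun s => ?_))
  simp only [Set.mem_ofPred_eq, hJ J le_rfl]
  have : (a : ℕ∞) ≤ c := by exact_mod_cast hac
  exact ⟨fun h => ⟨h.1.1, h.2.2⟩, fun h => ⟨⟨h.1, this.trans_lt h.2⟩, h.1.trans hac, h.2⟩⟩

end Exhaustion

/-! ### From ranks to persistence diagrams. -/

section Multiplicity

variable {F : Type u} [Field F] {M : PersistenceModule F ℕ} {S : Type} [Finite S]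
  {b : S → ℕ} {d : S → ℕ∞}

/-- The two sets counted are nested, so the truncated subtraction is the cardinality of their
difference. -/
theorem bornAt_eq
    (hM : ∀ a c, a ≤ c → structureRank M a c = {s | b s ≤ a ∧ (c : ℕ∞) < d s}.ncard)
    {β c : ℕ} (h : β ≤ c) : bornAt M β c = {s | b s = β ∧ (c : ℕ∞) < d s}.ncard := by
  rw [bornAt, hM _ _ h]
  split_ifs with h0
  · have hsub : {s | b s ≤ β - 1 ∧ (c : ℕ∞) < d s} ⊆ {s | b s ≤ β ∧ (c : ℕ∞) < d s} :=
      fun s hs => ⟨hs.1.trans (Nat.sub_le _ _), hs.2⟩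
    rw [hM _ _ (by omega), ← Set.ncard_sdiff hsub (Set.toFinite _)]
    congr 1
    ext s
    simp only [Set.mem_sdiff, Set.mem_ofPred_eq]
    constructor
    · rintro ⟨⟨h1, h2⟩, h3⟩
      exact ⟨by_contra fun h4 => h3 ⟨by omega, h2⟩, h2⟩
    · rintro ⟨h1, h2⟩
      exact ⟨⟨h1.le, h2⟩, fun h3 => by omega⟩
  · obtain rfl : β = 0 := by omega
    simp

theorem pointMultiplicity_eq
    (hM : ∀ a c, a ≤ c → structureRank M a c = {s | b s ≤ a ∧ (c : ℕ∞) < d s}.ncard)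
    {β : ℕ} {δ : ℕ∞} (h : (β : ℕ∞) < δ) :
    pointMultiplicity M β δ = {s | b s = β ∧ d s = δ}.ncard := by
  induction δ using ENat.recTopCoe with
  | top =>
    have hle (n : ℕ) : {s | b s = β ∧ d s = ⊤}.ncard ≤ bornAt M β (β + n) := by
      rw [bornAt_eq hM le_self_add]
      refine Set.ncard_le_ncard (fun s hs => ⟨hs.1, ?_⟩) (Set.toFinite _)
      rw [hs.2]
      exact ENat.natCast_lt_top _
    -- `n` bounds all finite deaths (`toNat` sends `⊤` to 0), so an interval alive at `β + n` never
    -- dies.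
    obtain ⟨n, hn⟩ := (Set.finite_range fun s => (d s).toNat).bddAbove
    refine le_antisymm ((ciInf_le (OrderBot.bddBelow _) n).trans ?_) (le_ciInf hle)
    rw [bornAt_eq hM le_self_add]
    refine Set.ncard_le_ncard (fun s hs => ⟨hs.1, ?_⟩) (Set.toFinite _)
    by_contra htop
    have h1 : (d s).toNat ≤ n := hn ⟨s, rfl⟩
    have h2 := hs.2
    rw [← ENat.natCast_toNat htop, Nat.cast_lt] at h2
    omega
  | coe n =>
    have hn : β < n := by exact_mod_cast h
    change bornAt M β (n - 1) - bornAt M β n = _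
    rw [bornAt_eq hM (by omega), bornAt_eq hM hn.le, ← Set.ncard_sdiff _ (Set.toFinite _)]
    · congr 1
      ext s
      simp only [Set.mem_sdiff, Set.mem_ofPred_eq]
      induction d s using ENat.recTopCoe with
      | top =>
        have h1 : ((n - 1 : ℕ) : ℕ∞) < ⊤ := ENat.natCast_lt_top _
        have h2 : (n : ℕ∞) < ⊤ := ENat.natCast_lt_top _
        have h3 : (⊤ : ℕ∞) ≠ n := h2.ne'
        tauto
      | coe m =>
        simp only [Nat.cast_lt, Nat.cast_inj]
        omega
    · refine fun s hs => ⟨hs.1, lt_of_le_of_lt ?_ hs.2⟩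
      exact_mod_cast Nat.sub_le _ _

theorem Diagram.ext {s t : Diagram M} (h1 : s.birth = t.birth) (h2 : s.death = t.death)
    (h3 : s.1.2 = t.1.2) : s = t :=
  Subtype.ext (Prod.ext (Prod.ext h1 h2) h3)

instance : Countable (Diagram M) := inferInstanceAs (Countable {_t : (ℕ × ℕ∞) × ℕ // _})

instance : Infinite (Diagram M) :=
  Infinite.of_injective
    (fun n : ℕ => (⟨((0, 0), n), le_rfl, fun h => absurd h (lt_irrefl _)⟩ : Diagram M))
    fun _ _ h => congrArg (fun s : Diagram M => s.1.2) h

/-- The intervals of a decomposition are represented by distinct points of the persistence diagram,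
and the other points are on the diagonal. -/
theorem exists_injective_diagram (hbd : ∀ s, (b s : ℕ∞) ≤ d s)
    (hM : ∀ a c, a ≤ c → structureRank M a c = {s | b s ≤ a ∧ (c : ℕ∞) < d s}.ncard) :
    ∃ α : S → Diagram M, Function.Injective α ∧ (∀ s, (α s).birth = b s ∧ (α s).death = d s) ∧
      ∀ t, t ∉ Set.range α → t.OnDiagonal := by
  -- Intervals with the same endpoints are numbered, and the number becomes the copy index in the
  -- diagram. Off the diagonal the fibre has exactly as many elements as the multiplicity; on the
  -- diagonal any index is allowed.
  let fibre (p : ℕ × ℕ∞) : Type := {s // b s = p.1 ∧ d s = p.2}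
  let enum (p : ℕ × ℕ∞) : fibre p ≃ Fin (Nat.card (fibre p)) := Finite.equivFin _
  have hcard {p : ℕ × ℕ∞} (h : (p.1 : ℕ∞) < p.2) :
      pointMultiplicity M p.1 p.2 = Nat.card (fibre p) := pointMultiplicity_eq hM h
  let α (s : S) : Diagram M := ⟨((b s, d s), enum (b s, d s) ⟨s, rfl, rfl⟩), hbd s, fun h => by
    rw [hcard (p := (b s, d s)) h]
    exact Fin.is_lt _⟩
  refine ⟨α, ?_, fun s => ⟨rfl, rfl⟩, ?_⟩
  · intro s t hst
    -- Separate `p` and `q` let equality of endpoints be substituted before comparing numbers in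
    -- fibres of different types.
    have key : ∀ (p q : ℕ × ℕ∞) (x : fibre p) (y : fibre q), p = q →
        (enum p x : ℕ) = enum q y → x.1 = y.1 := by
      rintro p _ x y rfl h
      rw [(enum p).injective (Fin.ext h)]
    exact key _ _ ⟨s, rfl, rfl⟩ ⟨t, rfl, rfl⟩ (congrArg (fun s : Diagram M => s.1.1) hst)
      (congrArg (fun s : Diagram M => s.1.2) hst)
  · rintro ⟨⟨p, n⟩, h1, h2⟩ ht
    by_contra hdiag
    have h3 : (p.1 : ℕ∞) < p.2 := lt_of_le_of_ne h1 hdiag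
    have h4 : n < Nat.card (fibre p) := hcard h3 ▸ h2 h3
    refine ht ⟨((enum p).symm ⟨n, h4⟩).1, ?_⟩
    obtain ⟨s, hs⟩ : ∃ s, s = (enum p).symm ⟨n, h4⟩ := ⟨_, rfl⟩
    rw [← hs]
    obtain ⟨s, hb, hd⟩ := s
    obtain ⟨β, δ⟩ := p
    dsimp only at hb hd
    subst hb hd
    refine Diagram.ext rfl rfl ?_
    change (enum (b s, d s) ⟨s, rfl, rfl⟩ : ℕ) = n
    rw [hs, Equiv.apply_symm_apply]

end Multiplicity

/-- Two injections of a finite type in countably infinite types differ by a bijection. -/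
theorem exists_equiv_of_injective {S α β : Type*} [Finite S] [Countable α] [Infinite α]
    [Countable β] [Infinite β] {i : S → α} {j : S → β} (hi : Function.Injective i)
    (hj : Function.Injective j) :
    ∃ γ : α ≃ β, (∀ s, γ (i s) = j s) ∧ ∀ a, a ∉ Set.range i → γ a ∉ Set.range j := by
  classical
  have h1 : Infinite ↑(Set.range i)ᶜ := (Set.finite_range i).infinite_compl.to_subtype
  have h2 : Infinite ↑(Set.range j)ᶜ := (Set.finite_range j).infinite_compl.to_subtype
  have h3 : Countable ↑(Set.range i)ᶜ := Subtype.countable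
  have h4 : Countable ↑(Set.range j)ᶜ := Subtype.countable
  obtain ⟨e⟩ := nonempty_equiv_of_countable (α := ↑(Set.range i)ᶜ) (β := ↑(Set.range j)ᶜ)
  refine ⟨(Equiv.Set.sumCompl (Set.range i)).symm.trans
    ((Equiv.sumCongr ((Equiv.ofInjective i hi).symm.trans (Equiv.ofInjective j hj)) e).trans
      (Equiv.Set.sumCompl (Set.range j))), fun s => ?_, fun a ha => ?_⟩
  · rw [Equiv.trans_apply, Equiv.Set.sumCompl_symm_apply_of_mem (Set.mem_range_self s)]
    simp
  · rw [Equiv.trans_apply, Equiv.Set.sumCompl_symm_apply_of_notMem ha]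
    exact (e ⟨a, ha⟩).2

/-- Nonemptiness rules out `p = ∞` and `p = q`; the latter is why the two projected points are not
both diagonal. Since `q` is a finite point or `∞`, its two coordinates are infinite together. -/
theorem exists_hook_eq {p q : WithTop (ℕ × ℕ)} (hpq : p ≤ q) (hne : (hook p q).Nonempty) :
    ∃ (b : ℕ × ℕ) (d : ℕ∞ × ℕ∞),
      hook p q = {r | b ≤ r ∧ ¬ (d.1 ≤ (r.1 : ℕ∞) ∧ d.2 ≤ (r.2 : ℕ∞))} ∧
      (b.1 : ℕ∞) ≤ d.1 ∧ (b.2 : ℕ∞) ≤ d.2 ∧ ¬ ((b.1 : ℕ∞) = d.1 ∧ (b.2 : ℕ∞) = d.2) ∧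
      (d.1 = ⊤ ↔ d.2 = ⊤) := by
  obtain ⟨r, hr1, hr2⟩ := hne
  induction p using WithTop.recTopCoe with
  | top => exact absurd hr1 (by simp)
  | coe b =>
    induction q using WithTop.recTopCoe with
    | top =>
      refine ⟨b, (⊤, ⊤), ?_, le_top, le_top, fun h => ENat.natCast_ne_top _ h.1, by simp⟩
      ext r
      simp [hook]
    | coe c =>
      have hbc : b ≤ c := WithTop.coe_le_coe.1 hpq
      refine ⟨b, (c.1, c.2), ?_, Nat.cast_le.2 hbc.1, Nat.cast_le.2 hbc.2, fun h => hr2 ?_, by simp⟩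
      · ext r
        simp [hook, Prod.le_def]
      · have : b = c := Prod.ext (Nat.cast_inj.1 h.1) (Nat.cast_inj.1 h.2)
        rwa [← this]

/-! ### Distance zero means isomorphic. -/

section Interleaving

variable {F : Type u} [Field F]

theorem interleaved_zero_of_iso {M N : PersistenceModule F (ℕ × ℕ)} (e : M ≅ N) :
    Interleaved M N 0 := by
  refine ⟨⟨e.hom.app, e.hom.naturality⟩, ⟨e.inv.app, e.inv.naturality⟩, fun r => ⟨?_, ?_⟩⟩
  · exact (e.hom_inv_id_app r).trans (M.map_id r).symm
  · exact (e.inv_hom_id_app r).trans (N.map_id r).symm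

theorem nonempty_iso_of_interleaved_zero {M N : PersistenceModule F (ℕ × ℕ)}
    (h : Interleaved M N 0) : Nonempty (M ≅ N) := by
  obtain ⟨φ, ψ, h⟩ := h
  refine ⟨⟨⟨φ.app, φ.naturality⟩, ⟨ψ.app, ψ.naturality⟩, ?_, ?_⟩⟩
  · ext1
    exact funext fun r => (h r).1.trans (M.map_id r)
  · ext1
    exact funext fun r => (h r).2.trans (N.map_id r)

theorem interleavingDistance_eq_zero_iff {M N : PersistenceModule F (ℕ × ℕ)} :
    interleavingDistance M N = 0 ↔ Nonempty (M ≅ N) := by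
  constructor
  · intro h
    -- An empty set would have infimum `∞`; a nonempty one attains its infimum.
    have hne : {e : ℕ∞ | ∃ δ : ℕ, e = δ ∧ Interleaved M N δ}.Nonempty := by
      rw [Set.nonempty_iff_ne_empty]
      intro h1
      rw [interleavingDistance, h1, sInf_empty] at h
      exact ENat.top_ne_zero h
    obtain ⟨δ, h1, h2⟩ := csInf_mem hne
    have h3 : δ = 0 := by exact_mod_cast h1.symm.trans h
    subst h3
    exact nonempty_iso_of_interleaved_zero h2
  · rintro ⟨e⟩
    exact le_antisymm (sInf_le ⟨0, rfl, interleaved_zero_of_iso e⟩) zero_le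

end Interleaving

/-! ### Matching the two diagrams through the hooks. -/

/-- Beyond the second birth and the second death only the first coordinates matter. If the second
death is `∞`, so is the first by `htop`, hence the value 0 of `toNat` at `⊤` does no harm. -/
theorem alive_iff_of_le {S : Type} {birth : S → ℕ × ℕ} {death : S → ℕ∞ × ℕ∞} {s : S}
    (htop : (death s).1 = ⊤ ↔ (death s).2 = ⊤) {i j : ℕ} (hb : (birth s).2 ≤ j)
    (hd : (death s).2.toNat ≤ j) :
    Alive birth death s (i, j) ↔ (birth s).1 ≤ i ∧ (i : ℕ∞) < (death s).1 := by
  rw [← not_le]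
  refine and_congr ⟨fun h => h.1, fun h => ⟨h, hb⟩⟩ (not_congr ⟨fun h => h.1, fun h => ⟨h, ?_⟩⟩)
  have h1 : (death s).1 ≠ ⊤ := (h.trans_lt (ENat.natCast_lt_top i)).ne
  rw [← ENat.natCast_toNat fun h2 => h1 (htop.2 h2)]
  exact_mod_cast hd

/-- The exchange of the two components of a bidegree. -/
def bidegreeSwap : ℕ × ℕ →o ℕ × ℕ where
  toFun := Prod.swap
  monotone' _ _ h := Prod.swap_le_swap.2 h

theorem alive_swap_iff {S : Type} {birth : S → ℕ × ℕ} {death : S → ℕ∞ × ℕ∞} {s : S} {r : ℕ × ℕ} :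
    Alive birth death s (bidegreeSwap r) ↔
      Alive (fun s => (birth s).swap) (fun s => (death s).swap) s r :=
  and_congr and_comm (not_congr and_comm)

/-- If `B` is hook-decomposable and its colimits in the two directions are `M` and `N`, then `B` is
the `γ`-product of `M` and `N` for some `γ`. -/
theorem exists_iso_gammaProduct {F : Type u} [Field F] {B : PersistenceModule F (ℕ × ℕ)}
    {M N : PersistenceModule F ℕ} (hB : IsFiniteType B) (hhook : IsHookDecomposable B)
    (EM : Exhausts B M OrderHom.id) (EN : Exhausts B N bidegreeSwap) :
    ∃ γ : Diagram M ≃ Diagram N, Nonempty (B ≅ gammaProduct γ) := by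
  obtain ⟨ι, p, q, hpq, ⟨iso⟩⟩ := hhook
  have hI (i : ι) := ordConnected_hook (p i) (q i)
  have hfin := finite_nonempty_of_isFiniteType hI hB iso
  have := hfin.to_subtype
  -- Generators are indexed by a type in universe 0, unlike `ι`; finiteness allows reindexing by
  -- `Fin`.
  let e₀ := Finite.equivFin {i | (hook (p i) (q i)).Nonempty}
  let S := Fin (Nat.card {i | (hook (p i) (q i)).Nonempty})
  let e (s : S) : ι := (e₀.symm s).1
  have he_inj : Function.Injective e := Subtype.val_injective.comp e₀.symm.injective
  have he_range (i : ι) (hi : i ∉ Set.range e) : hook (p i) (q i) = ∅ := by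
    by_contra h
    exact hi ⟨e₀ ⟨i, Set.nonempty_iff_ne_empty.2 h⟩, congrArg Subtype.val (e₀.symm_apply_apply _)⟩
  choose birth death hsupp hbd₁ hbd₂ hne htop using
    fun s : S => exists_hook_eq (hpq (e s)) (e₀.symm s).2
  have isoS := iso ≪≫ (presentedModuleIso (F := F) hsupp hI he_inj he_range).symm
  -- One bound on all births and finite deaths serves both colimit directions.
  obtain ⟨J, hJ⟩ := (Set.finite_range fun s => (birth s).1 + (birth s).2 + (death s).1.toNat +
    (death s).2.toNat).bddAbove
  replace hJ (s : S) : (birth s).1 + (birth s).2 + (death s).1.toNat + (death s).2.toNat ≤ J :=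
    hJ ⟨s, rfl⟩
  obtain ⟨α, hα, hα', hαdiag⟩ := exists_injective_diagram hbd₁ fun a c hac =>
    (EM.ofIso isoS.symm).structureRank_eq (J := J) (fun j hj s i =>
      alive_iff_of_le (htop s) (by linarith [hJ s]) (by linarith [hJ s])) hac
  obtain ⟨β, hβ, hβ', hβdiag⟩ := exists_injective_diagram hbd₂ fun a c hac =>
    (EN.ofIso isoS.symm).structureRank_eq (J := J) (fun j hj s i =>
      alive_swap_iff.trans (alive_iff_of_le (htop s).symm
        (show (birth s).1 ≤ j by linarith [hJ s])
        (show (death s).1.toNat ≤ j by linarith [hJ s]))) hac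
  obtain ⟨γ, hγ, hγ'⟩ := exists_equiv_of_injective hα hβ
  -- A point outside the image of `α` is diagonal, and its image under `γ` lies outside the image of
  -- `β`, so is diagonal too: it carries no generator.
  have hgen (t : GeneratorIndex γ) : ∃ s, α s = t.1 := by
    by_contra h
    exact t.2 ⟨hαdiag _ h, hβdiag _ (hγ' _ h)⟩
  choose σ hσ using hgen
  refine ⟨γ, ⟨iso ≪≫ (presentedModuleIso (e := fun t => e (σ t)) (fun t => ?_) hI ?_ ?_).symm⟩⟩
  · have h1 := hα' (σ t)
    have h2 := hβ' (σ t)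
    rw [← hγ] at h2
    rw [hσ] at h1 h2
    simp only [Alive]
    rw [hsupp, h1.1, h1.2, h2.1, h2.2]
  · intro t t' h
    refine Subtype.ext ?_
    rw [← hσ, ← hσ, he_inj h]
  · intro i hi
    refine he_range i fun ⟨s, hs⟩ => hi ?_
    -- Every nonempty hook does give a generator, since by `hne` its two points are not both
    -- diagonal.
    refine ⟨⟨α s, fun h => hne s ⟨?_, ?_⟩⟩, ?_⟩
    · rw [← (hα' s).1, ← (hα' s).2]
      exact h.1
    · rw [← (hβ' s).1, ← (hβ' s).2, ← hγ]
      exact h.2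
    · rw [← hs]
      exact congrArg e (hα (hσ _))

end PersistenceProduct

end

theorem mainTheorem1 {X : Type u} [TopologicalSpace X] {F : Type u} [Field F] (k : ℕ)
    (f g : X → ℕ)
    (hf : ∀ K : Set X, IsCompact K → BddAbove (f '' K))
    (hg : ∀ K : Set X, IsCompact K → BddAbove (g '' K))
    (hMf : IsFiniteType (persistenceModule F k f))
    (hMg : IsFiniteType (persistenceModule F k g))
    (hMfg : IsFiniteType (persistenceModule F k fun x => (f x, g x)))
    (hhook : IsHookDecomposable (persistenceModule F k fun x => (f x, g x))) :
    (∃ γ : Diagram (persistenceModule F k f) ≃ Diagram (persistenceModule F k g),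
      IsGammaBar (persistenceModule F k fun x => (f x, g x)) γ) ∧
    ∀ γ : Diagram (persistenceModule F k f) ≃ Diagram (persistenceModule F k g),
      IsGammaBar (persistenceModule F k fun x => (f x, g x)) γ →
      Nonempty (persistenceModule F k (fun x => (f x, g x)) ≅ gammaProduct γ) := by
  obtain ⟨γ, hγ⟩ := exists_iso_gammaProduct hMfg hhook
    (exhausts_persistenceModule (f := f) (g := g) (fun _ _ _ => Iff.rfl) k hg)
    (exhausts_persistenceModule (f := g) (g := f) (fun _ _ _ => and_comm) k hf)
  have h0 := interleavingDistance_eq_zero_iff.2 hγ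
  -- The bijection just found attains 0, so minimizing means having distance 0.
  have hinf : ⨅ γ' : Diagram (persistenceModule F k f) ≃ Diagram (persistenceModule F k g),
      interleavingDistance (persistenceModule F k fun x => (f x, g x)) (gammaProduct γ') = 0 :=
    le_antisymm ((iInf_le _ γ).trans h0.le) zero_le
  exact ⟨⟨γ, h0.trans hinf.symm⟩, fun γ' h => interleavingDistance_eq_zero_iff.1 (h.trans hinf)⟩
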